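/- Let $X^*$ be a random target in $\mathcal X\subset\mathbb R^d$ with prior probability density $p_0$ of finite differential entropy, $\int p_0|\log_2 p_0|\,dx<\infty$, and let there be $M$ players. At each time $n=0,\dots,N-1$ a controller chooses, as a function of the responses $Y_1,\dots,Y_n\in\{0,1\}$ received so far, one player $u_n\in\{1,\dots,M\}$ and a query region $A_n$, which must be a union of at most $J_n(u_n)$ half-open rectangles $[a_1,b_1)\times\cdots\times[a_d,b_d)\subseteq\mathcal X$. Given $X^*$ and the past, the response $Y_{n+1}$ of player $u_n$ is the output of a binary symmetric channel with input $I(X^*\in A_n)$ and known crossover probability $\epsilon_n(u_n)\in(0,1/2)$: it equals the input with probability $1-\epsilon_n(u_n)$. Let $p_n$ be the posterior density of $X^*$ after $n$ responses, given by Bayes' rule, let $H(p)=-\int p\log_2 p\,dx$, and let $T_N=\sum_{k=0}^{N-1}K_k(u_k,A_k)$ be the total cost, where $K_k(u,A)\in\mathbb R$ is the cost of asking player $u$ the query $A$ at time $k$. For $\gamma\ge 0$ consider the problem $$\inf_\zeta \mathbb E^\zeta\left[H(p_N)+\gamma T_N\right],$$ where $\zeta$ ranges over all such policies. Assume that the cost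 is independent of the query, $K_k(u,A)=K_k(u)$, and let $C_n(u)=1-h_b(\epsilon_n(u))$ be the Shannon capacity (in bits) of the channel of player $u$ at time $n$, where $h_b(\epsilon)=-\epsilon\log_2\epsilon-(1-\epsilon)\log_2(1-\epsilon)$. Then a policy is optimal, i.e. attains this infimum, if for every $n=0,\dots,N-1$ and all responses received so far the selected player $u_n$ attains $$\max_{u\in\{1,\dots,M\}}\left\{C_n(u)-\gamma K_n(u)\right\}$$ and the query $A_n$ is a bisection of the posterior density, $\int_{A_n}p_n(x)\,dx=\tfrac12$. -/

import Mathlib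

open MeasureTheory

noncomputable section

namespace TwentyQuestions

/-- The target space `ℝ^d`, with Lebesgue measure `volume`. -/
abbrev Target (d : ℕ) : Type := Fin d → ℝ

/-- Differential entropy in bits, `H(p) = -∫ p(x) log₂ p(x) dx`. -/
def entropy {d : ℕ} (p : Target d → ℝ) : ℝ :=
  -∫ x, p x * Real.logb 2 (p x)

/-- `p` is a probability density on `ℝ^d` that is supported in `S`. -/
structure IsDensityOn {d : ℕ} (S : Set (Target d)) (p : Target d → ℝ) : Prop where
  measurable : Measurable p
  nonneg : ∀ x, 0 ≤ p x
  eq_zero : ∀ x, x ∉ S → p x = 0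
  integrable : Integrable p volume
  integral_eq_one : ∫ x, p x = 1

/-- The probability mass a density `p` gives to a set `A`. -/
def mass {d : ℕ} (p : Target d → ℝ) (A : Set (Target d)) : ℝ :=
  ∫ x in A, p x

/-- Transition probabilities `W(y | z)` of the binary symmetric channel with crossover
probability `ε` (first Boolean argument: input `z`, second one: output `y`). -/
def bsc (ε : ℝ) (z y : Bool) : ℝ :=
  if y = z then 1 - ε else ε

/-- Mutual information (in bits) between the input, distributed as `π`, and the output of the
binary-input binary-output channel `W`. -/
def mutualInfo (π : Bool → ℝ) (W : Bool → Bool → ℝ) : ℝ :=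
  ∑ z, ∑ y, π z * W z y * Real.logb 2 (W z y / ∑ z', π z' * W z' y)

/-- Shannon capacity (in bits) of a binary-input binary-output channel: the supremum of the mutual
information over all input distributions. -/
def capacity (W : Bool → Bool → ℝ) : ℝ :=
  sSup {c : ℝ | ∃ π : Bool → ℝ, (∀ z, 0 ≤ π z) ∧ ∑ z, π z = 1 ∧ c = mutualInfo π W}

/-- The true answer `I(x ∈ A)` to the question whether `x` lies in `A`. -/
def truth {d : ℕ} (A : Set (Target d)) (x : Target d) : Bool :=
  open Classical in decide (x ∈ A)

/-- Bayes' rule: the posterior density when the density `p` is updated with the response `y` of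
a player with crossover probability `ε` to the query region `A`. -/
def bayesUpdate {d : ℕ} (ε : ℝ) (A : Set (Target d)) (y : Bool) (p : Target d → ℝ) :
    Target d → ℝ :=
  fun x => bsc ε (truth A x) y * p x / ∫ x', bsc ε (truth A x') y * p x'

/-- The half-open rectangle `[a₁, b₁) × ⋯ × [a_d, b_d)`. -/
def rectangle {d : ℕ} (a b : Target d) : Set (Target d) :=
  Set.pi Set.univ fun l => Set.Ico (a l) (b l)

/-- `A` is a union of at most `J` half-open rectangles contained in `S`. -/
def IsQueryRegion {d : ℕ} (S : Set (Target d)) (J : ℕ) (A : Set (Target d)) : Prop :=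
  ∃ j ≤ J, ∃ a b : Fin j → Target d,
    (∀ i l, a i l ≤ b i l) ∧ (∀ i, rectangle (a i) (b i) ⊆ S) ∧
      A = ⋃ i, rectangle (a i) (b i)

/-- The data of the player-selection problem with `M` players and a target in `ℝ^d`. -/
structure Problem (d M : ℕ) where
  /-- the region containing the target -/
  domain : Set (Target d)
  /-- the prior density of the target -/
  prior : Target d → ℝ
  /-- crossover probability of each player at each time -/
  crossover : ℕ → Fin M → ℝ
  /-- maximal number of rectangles in a query to each player at each time -/
  maxRect : ℕ → Fin M → ℕ
  /-- `cost k u A` is the cost of asking player `u` the query `A` at time `k` -/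
  cost : ℕ → Fin M → Set (Target d) → ℝ
  /-- the tradeoff parameter -/
  γ : ℝ
  /-- the number of questions -/
  horizon : ℕ

/-- A control policy: at time `n`, when the responses `y₁, …, yₙ` have been received, it selects the
player to be asked and the query. (The earlier players and queries are functions of the earlier
responses, so they carry no further information.) -/
structure Policy (d M : ℕ) where
  player : (n : ℕ) → (Fin n → Bool) → Fin M
  query : (n : ℕ) → (Fin n → Bool) → Set (Target d)

namespace Problem

variable {d M : ℕ} (P : Problem d M)

/-- Capacity `C_n(u)` of player `u` at time `n`. -/
def playerCapacity (n : ℕ) (u : Fin M) : ℝ :=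
  capacity (bsc (P.crossover n u))

/-- A policy is admissible if all its queries up to the horizon are permitted query regions. -/
def Admissible (ζ : Policy d M) : Prop :=
  ∀ n < P.horizon, ∀ y : Fin n → Bool,
    IsQueryRegion P.domain (P.maxRect n (ζ.player n y)) (ζ.query n y)

/-- The posterior density `p_n` after the responses `y`. -/
def posterior (ζ : Policy d M) : (n : ℕ) → (Fin n → Bool) → Target d → ℝ
  | 0, _ => P.prior
  | n + 1, y =>
      bayesUpdate (P.crossover n (ζ.player n (Fin.init y))) (ζ.query n (Fin.init y))
        (y (Fin.last n)) (posterior ζ n (Fin.init y))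

/-- The cost `T_n = ∑_{k < n} K_k(u_k, A_k)` incurred when the responses are `y`. -/
def totalCost (ζ : Policy d M) : (n : ℕ) → (Fin n → Bool) → ℝ
  | 0, _ => 0
  | n + 1, y =>
      totalCost ζ n (Fin.init y) +
        P.cost n (ζ.player n (Fin.init y)) (ζ.query n (Fin.init y))

/-- The conditional probability, given that the target is at `x`, that the first `n` responses
are `y`: each response is the output of the memoryless channel of the player selected, whose input is
the true answer to the query. -/
def likelihood (ζ : Policy d M) : (n : ℕ) → Target d → (Fin n → Bool) → ℝ
  | 0, _, _ => 1
  | n + 1, x, y =>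
      likelihood ζ n x (Fin.init y) *
        bsc (P.crossover n (ζ.player n (Fin.init y))) (truth (ζ.query n (Fin.init y)) x)
          (y (Fin.last n))

/-- The joint law, under the policy `ζ`, of the target and of the responses up to the horizon. -/
def law (ζ : Policy d M) : Measure (Target d × (Fin P.horizon → Bool)) :=
  ((volume : Measure (Target d)).prod Measure.count).withDensity fun ω =>
    ENNReal.ofReal (P.prior ω.1 * P.likelihood ζ P.horizon ω.1 ω.2)

/-- The criterion `E^ζ[H(p_N) + γ T_N]`. -/
def objective (ζ : Policy d M) : ℝ :=
  ∫ ω, (entropy (P.posterior ζ P.horizon ω.2) + P.γ * P.totalCost ζ P.horizon ω.2) ∂(P.law ζ)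

/-- `ζ` attains the infimum of the criterion over all admissible policies. -/
def IsOptimal (ζ : Policy d M) : Prop :=
  P.Admissible ζ ∧ IsLeast (P.objective '' {ξ | P.Admissible ξ}) (P.objective ζ)

end Problem

end TwentyQuestions

end

noncomputable section

namespace TwentyQuestions

variable {d M : ℕ}

/-! ### The binary symmetric channel -/

/-! Asking one question lowers the conditional expectation of `H + γT` by the mutual information
between true answer and response, minus `γ` times the cost (`sum_responseProb_mul_entropy`,
`expectedValue_succ`). Mutual information never exceeds capacity (`mutualInfo_le_capacity_bsc`),
with equality when the answer is a fair coin, i.e. for a bisection (`mutualInfo_bsc_eq_capacity`).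
Capacity and cost depend on neither the query nor the history, so the gain at time `n` is at most a
deterministic constant `G n`. Telescoping bounds every admissible policy below by `entropy P.prior -
∑ G k`, and the given policy meets this bound at each step; no backward induction is needed.
`integral_law` turns the criterion into a finite sum over response strings. -/

lemma bsc_pos {ε : ℝ} (hε : ε ∈ Set.Ioo (0 : ℝ) (1 / 2)) (z y : Bool) : 0 < bsc ε z y := by
  obtain ⟨h0, h1⟩ := hε
  unfold bsc
  split_ifs <;> linarith

lemma sum_bsc (ε : ℝ) (z : Bool) : ∑ y, bsc ε z y = 1 := by
  cases z <;> simp [bsc]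

/-- Mutual information over a binary symmetric channel is output entropy minus noise entropy. -/
lemma mutualInfo_bsc {ε : ℝ} (hε : ε ∈ Set.Ioo (0 : ℝ) (1 / 2)) {π : Bool → ℝ}
    (hπ : ∀ z, 0 ≤ π z) (hsum : ∑ z, π z = 1) :
    mutualInfo π (bsc ε) =
      (Real.binEntropy (∑ z, π z * bsc ε z true) - Real.binEntropy ε) / Real.log 2 := by
  obtain ⟨h0, h1⟩ := hε
  have ht := hπ true
  have hf := hπ false
  simp only [Fintype.sum_bool] at hsum
  have hπf : π false = 1 - π true := by linarith
  rw [hπf] at hf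
  have hl : Real.log 2 ≠ 0 := (Real.log_pos one_lt_two).ne'
  -- Channel noise keeps both output probabilities positive even for a deterministic input, so every
  -- logarithm of a quotient splits.
  have hq1 : 0 < π true * (1 - ε) + (1 - π true) * ε := by nlinarith
  have hq0 : 0 < π true * ε + (1 - π true) * (1 - ε) := by nlinarith
  have e1 : (1 - ε : ℝ) ≠ 0 := by linarith
  have hc : 1 - (π true * (1 - ε) + (1 - π true) * ε)
      = π true * ε + (1 - π true) * (1 - ε) := by ring
  simp only [mutualInfo, bsc, Fintype.sum_bool, Real.binEntropy_eq_negMulLog_add_negMulLog_one_sub,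
    Real.negMulLog, Real.logb, hπf]
  simp only [if_true, reduceCtorEq, if_false]
  rw [hc, Real.log_div e1 hq1.ne', Real.log_div e1 hq0.ne', Real.log_div h0.ne' hq1.ne',
    Real.log_div h0.ne' hq0.ne']
  field_simp
  ring

lemma mutualInfo_bsc_le {ε : ℝ} (hε : ε ∈ Set.Ioo (0 : ℝ) (1 / 2)) {π : Bool → ℝ}
    (hπ : ∀ z, 0 ≤ π z) (hsum : ∑ z, π z = 1) :
    mutualInfo π (bsc ε) ≤ (Real.log 2 - Real.binEntropy ε) / Real.log 2 := by
  rw [mutualInfo_bsc hε hπ hsum]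
  have := Real.log_pos one_lt_two
  gcongr
  exact Real.binEntropy_le_log_two

lemma mutualInfo_le_capacity_bsc {ε : ℝ} (hε : ε ∈ Set.Ioo (0 : ℝ) (1 / 2)) {π : Bool → ℝ}
    (hπ : ∀ z, 0 ≤ π z) (hsum : ∑ z, π z = 1) :
    mutualInfo π (bsc ε) ≤ capacity (bsc ε) :=
  le_csSup ⟨_, by rintro _ ⟨π', h, h', rfl⟩; exact mutualInfo_bsc_le hε h h'⟩ ⟨π, hπ, hsum, rfl⟩

/-- By symmetry of the channel a uniform input gives a uniform output, where binary entropy reaches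
its maximum `log 2`. -/
lemma mutualInfo_bsc_eq_capacity {ε : ℝ} (hε : ε ∈ Set.Ioo (0 : ℝ) (1 / 2)) {π : Bool → ℝ}
    (hπ : ∀ z, π z = 1 / 2) : mutualInfo π (bsc ε) = capacity (bsc ε) := by
  have hnn : ∀ z, 0 ≤ π z := fun z => by rw [hπ]; norm_num
  have hsum : ∑ z, π z = 1 := by simp only [Fintype.sum_bool, hπ]; norm_num
  refine le_antisymm (mutualInfo_le_capacity_bsc hε hnn hsum) ?_
  refine csSup_le ⟨_, π, hnn, hsum, rfl⟩ ?_
  rintro _ ⟨π', h, h', rfl⟩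
  refine (mutualInfo_bsc_le hε h h').trans_eq ?_
  rw [mutualInfo_bsc hε hnn hsum, ← Real.binEntropy_two_inv]
  congr 3
  simp only [Fintype.sum_bool, hπ, bsc]
  norm_num
  ring

/-! ### Query regions and integrals of functions of the true answer -/

lemma IsQueryRegion.measurableSet {S : Set (Target d)} {J : ℕ} {A : Set (Target d)}
    (h : IsQueryRegion S J A) : MeasurableSet A := by
  obtain ⟨j, -, a, b, -, -, rfl⟩ := h
  exact MeasurableSet.iUnion fun i => MeasurableSet.univ_pi fun l => measurableSet_Ico

lemma measurable_truth {A : Set (Target d)} (hA : MeasurableSet A) : Measurable (truth A) := by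
  refine measurable_to_bool ?_
  convert hA
  ext x
  simp [truth]

lemma integrable_truth_mul {A : Set (Target d)} (hA : MeasurableSet A) (f : Bool → ℝ)
    {g : Target d → ℝ} (hg : Integrable g) : Integrable fun x => f (truth A x) * g x := by
  refine hg.bdd_mul (c := |f true| + |f false|)
    ((measurable_of_countable f).comp (measurable_truth hA)).aestronglyMeasurable
    (Filter.Eventually.of_forall fun x => ?_)
  rw [Real.norm_eq_abs]
  cases truth A x
  · linarith [abs_nonneg (f true)]
  · linarith [abs_nonneg (f false)]

/-- The law of the true answer `I(X ∈ A)` when `X` has density `p`. -/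
def answerLaw (p : Target d → ℝ) (A : Set (Target d)) (z : Bool) : ℝ :=
  if z then mass p A else mass p Aᶜ

lemma integral_truth_mul {A : Set (Target d)} (hA : MeasurableSet A) (f : Bool → ℝ)
    {p : Target d → ℝ} (hp : Integrable p) :
    ∫ x, f (truth A x) * p x = ∑ z, answerLaw p A z * f z := by
  rw [← integral_add_compl hA (integrable_truth_mul hA f hp)]
  have h1 : ∫ x in A, f (truth A x) * p x = ∫ x in A, f true * p x :=
    setIntegral_congr_fun hA fun x hx => by simp [truth, hx]
  have h2 : ∫ x in Aᶜ, f (truth A x) * p x = ∫ x in Aᶜ, f false * p x :=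
    setIntegral_congr_fun hA.compl fun x hx => by
      have hx' : x ∉ A := hx
      simp [truth, hx']
  rw [h1, h2, integral_const_mul, integral_const_mul]
  simp [answerLaw, mass, mul_comm]

lemma answerLaw_nonneg {p : Target d → ℝ} (hp : ∀ x, 0 ≤ p x) (A : Set (Target d)) (z : Bool) :
    0 ≤ answerLaw p A z := by
  unfold answerLaw mass
  split_ifs <;> exact integral_nonneg fun x => hp x

lemma sum_answerLaw {A : Set (Target d)} (hA : MeasurableSet A) {p : Target d → ℝ}
    (hp : Integrable p) (hone : ∫ x, p x = 1) : ∑ z, answerLaw p A z = 1 := by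
  simpa [hone] using (integral_truth_mul hA (fun _ => 1) hp).symm

/-! ### Bayes' rule -/

/-- A nonnegative function with integral one and finite differential entropy. -/
structure HasFiniteEntropy (p : Target d → ℝ) : Prop where
  nonneg : ∀ x, 0 ≤ p x
  integrable : Integrable p
  integral_eq_one : ∫ x, p x = 1
  integrable_mul_logb : Integrable fun x => p x * Real.logb 2 (p x)

/-- The probability of the response `y` when the target has density `p`. -/
def responseProb (ε : ℝ) (A : Set (Target d)) (p : Target d → ℝ) (y : Bool) : ℝ :=
  ∫ x, bsc ε (truth A x) y * p x

lemma responseProb_eq_sum {A : Set (Target d)} (hA : MeasurableSet A) (ε : ℝ)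
    {p : Target d → ℝ} (hp : Integrable p) (y : Bool) :
    responseProb ε A p y = ∑ z, answerLaw p A z * bsc ε z y :=
  integral_truth_mul hA (fun z => bsc ε z y) hp

lemma responseProb_pos {ε : ℝ} (hε : ε ∈ Set.Ioo (0 : ℝ) (1 / 2)) {A : Set (Target d)}
    (hA : MeasurableSet A) {p : Target d → ℝ} (hp : HasFiniteEntropy p) (y : Bool) :
    0 < responseProb ε A p y := by
  rw [responseProb_eq_sum hA ε hp.integrable]
  have hs := sum_answerLaw hA hp.integrable hp.integral_eq_one
  have ht := answerLaw_nonneg hp.nonneg A true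
  have hf := answerLaw_nonneg hp.nonneg A false
  have bt := bsc_pos hε true y
  have bf := bsc_pos hε false y
  simp only [Fintype.sum_bool] at hs ⊢
  rcases ht.lt_or_eq with h | h
  · exact add_pos_of_pos_of_nonneg (mul_pos h bt) (mul_nonneg hf bf.le)
  · rw [← h] at hs ⊢
    have : answerLaw p A false = 1 := by linarith
    rw [this]
    linarith

lemma sum_responseProb {A : Set (Target d)} (hA : MeasurableSet A) (ε : ℝ)
    {p : Target d → ℝ} (hp : HasFiniteEntropy p) : ∑ y, responseProb ε A p y = 1 := by
  simp only [responseProb_eq_sum hA ε hp.integrable]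
  rw [Finset.sum_comm]
  simp only [← Finset.mul_sum, sum_bsc, mul_one]
  exact sum_answerLaw hA hp.integrable hp.integral_eq_one

lemma responseProb_mul_bayesUpdate {ε : ℝ} (hε : ε ∈ Set.Ioo (0 : ℝ) (1 / 2))
    {A : Set (Target d)} (hA : MeasurableSet A) {p : Target d → ℝ} (hp : HasFiniteEntropy p)
    (y : Bool) (x : Target d) :
    responseProb ε A p y * bayesUpdate ε A y p x = bsc ε (truth A x) y * p x :=
  mul_div_cancel₀ _ (responseProb_pos hε hA hp y).ne'

/-- The logarithm turns Bayes' rule into a sum: an information term depending on `x` only through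
the true answer, plus the old entropy integrand. The prefactor clears the normalizer. -/
lemma bayesUpdate_mul_logb {ε : ℝ} (hε : ε ∈ Set.Ioo (0 : ℝ) (1 / 2))
    {A : Set (Target d)} (hA : MeasurableSet A) {p : Target d → ℝ} (hp : HasFiniteEntropy p)
    (y : Bool) (x : Target d) :
    responseProb ε A p y * (bayesUpdate ε A y p x * Real.logb 2 (bayesUpdate ε A y p x)) =
      bsc ε (truth A x) y * Real.logb 2 (bsc ε (truth A x) y / responseProb ε A p y) * p x +
        bsc ε (truth A x) y * (p x * Real.logb 2 (p x)) := by
  rw [← mul_assoc, responseProb_mul_bayesUpdate hε hA hp]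
  -- Where `p` vanishes the logarithm of the product does not split, but both sides are zero.
  rcases eq_or_ne (p x) 0 with h | h
  · simp [h]
  · have hq := responseProb_pos hε hA hp y
    have hb : bayesUpdate ε A y p x = bsc ε (truth A x) y / responseProb ε A p y * p x := by
      unfold bayesUpdate responseProb
      ring
    rw [hb, Real.logb_mul (div_ne_zero (bsc_pos hε _ _).ne' hq.ne') h]
    ring

lemma integrable_bayesUpdate_terms {A : Set (Target d)} (hA : MeasurableSet A) (ε q : ℝ)
    {p : Target d → ℝ} (hp : HasFiniteEntropy p) (y : Bool) :
    Integrable (fun x => bsc ε (truth A x) y * Real.logb 2 (bsc ε (truth A x) y / q) * p x) ∧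
      Integrable (fun x => bsc ε (truth A x) y * (p x * Real.logb 2 (p x))) :=
  ⟨integrable_truth_mul hA (fun z => bsc ε z y * Real.logb 2 (bsc ε z y / q)) hp.integrable,
    integrable_truth_mul hA (fun z => bsc ε z y) hp.integrable_mul_logb⟩

lemma HasFiniteEntropy.bayesUpdate {ε : ℝ} (hε : ε ∈ Set.Ioo (0 : ℝ) (1 / 2))
    {A : Set (Target d)} (hA : MeasurableSet A) {p : Target d → ℝ} (hp : HasFiniteEntropy p)
    (y : Bool) : HasFiniteEntropy (bayesUpdate ε A y p) where
  nonneg x := div_nonneg (mul_nonneg (bsc_pos hε _ _).le (hp.nonneg x))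
    (responseProb_pos hε hA hp y).le
  integrable := (integrable_truth_mul hA (fun z => bsc ε z y) hp.integrable).div_const _
  integral_eq_one := by
    unfold TwentyQuestions.bayesUpdate
    rw [integral_div]
    exact div_self (responseProb_pos hε hA hp y).ne'
  integrable_mul_logb := by
    obtain ⟨h1, h2⟩ := integrable_bayesUpdate_terms hA ε (responseProb ε A p y) hp y
    have hq := (responseProb_pos hε hA hp y).ne'
    refine (integrable_const_mul_iff (IsUnit.mk0 _ hq) _).1 ?_
    simp only [bayesUpdate_mul_logb hε hA hp y]
    exact h1.add h2

/-- The expected entropy after a response is the entropy before it minus the mutual information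
between the true answer and the response. -/
lemma sum_responseProb_mul_entropy {ε : ℝ} (hε : ε ∈ Set.Ioo (0 : ℝ) (1 / 2))
    {A : Set (Target d)} (hA : MeasurableSet A) {p : Target d → ℝ} (hp : HasFiniteEntropy p) :
    ∑ y, responseProb ε A p y * entropy (bayesUpdate ε A y p) =
      entropy p - mutualInfo (answerLaw p A) (bsc ε) := by
  have key (y : Bool) : responseProb ε A p y * entropy (bayesUpdate ε A y p) =
      -∑ z, answerLaw p A z * (bsc ε z y * Real.logb 2 (bsc ε z y / responseProb ε A p y)) -
        ∫ x, bsc ε (truth A x) y * (p x * Real.logb 2 (p x)) := by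
    obtain ⟨h1, h2⟩ := integrable_bayesUpdate_terms hA ε (responseProb ε A p y) hp y
    rw [entropy, mul_neg, ← integral_const_mul]
    simp only [bayesUpdate_mul_logb hε hA hp y]
    rw [integral_add h1 h2,
      integral_truth_mul hA (fun z => bsc ε z y * Real.logb 2 (bsc ε z y / responseProb ε A p y))
        hp.integrable]
    ring
  simp only [key, Finset.sum_sub_distrib, Finset.sum_neg_distrib]
  rw [← integral_finsetSum _ fun y _ =>
    integrable_truth_mul hA (fun z => bsc ε z y) hp.integrable_mul_logb]
  -- Summing over responses removes the channel from the old entropy term, which becomes exactly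
  -- `entropy p`.
  simp only [← Finset.sum_mul, sum_bsc, one_mul]
  rw [mutualInfo, Finset.sum_comm, entropy]
  simp only [responseProb_eq_sum hA ε hp.integrable, mul_assoc]
  ring

lemma answerLaw_eq_half {A : Set (Target d)} (hA : MeasurableSet A) {p : Target d → ℝ}
    (hp : HasFiniteEntropy p) (h : mass p A = 1 / 2) (z : Bool) : answerLaw p A z = 1 / 2 := by
  have hs := sum_answerLaw hA hp.integrable hp.integral_eq_one
  have ht : answerLaw p A true = 1 / 2 := h
  rw [Fintype.sum_bool] at hs
  cases z <;> linarith

/-! ### The expected value of a policy -/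

lemma sum_fin_succ_bool {n : ℕ} (f : (Fin (n + 1) → Bool) → ℝ) :
    ∑ y, f y = ∑ y : Fin n → Bool, ∑ b, f (Fin.snoc (α := fun _ => Bool) y b) := by
  rw [← (Fin.snocEquiv fun _ : Fin (n + 1) => Bool).sum_comp, Fintype.sum_prod_type,
    Finset.sum_comm]
  rfl

namespace Problem

variable (P : Problem d M)

/-- The probability that the first `n` responses are `y`. -/
def evidence (ξ : Policy d M) : (n : ℕ) → (Fin n → Bool) → ℝ
  | 0, _ => 1
  | n + 1, y => evidence ξ n (Fin.init y) *
      responseProb (P.crossover n (ξ.player n (Fin.init y))) (ξ.query n (Fin.init y))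
        (P.posterior ξ n (Fin.init y)) (y (Fin.last n))

/-- The expectation of `H(p_n) + γ T_n`. -/
def expectedValue (ξ : Policy d M) (n : ℕ) : ℝ :=
  ∑ y : Fin n → Bool,
    P.evidence ξ n y * (entropy (P.posterior ξ n y) + P.γ * P.totalCost ξ n y)

variable {P} {ξ : Policy d M}

lemma hasFiniteEntropy_posterior (hprior : HasFiniteEntropy P.prior)
    (hcrossover : ∀ n u, P.crossover n u ∈ Set.Ioo (0 : ℝ) (1 / 2)) (hξ : P.Admissible ξ) :
    ∀ n ≤ P.horizon, ∀ y, HasFiniteEntropy (P.posterior ξ n y)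
  | 0, _, _ => hprior
  | n + 1, hn, _ =>
    (hasFiniteEntropy_posterior hprior hcrossover hξ n (by omega) _).bayesUpdate
      (hcrossover _ _) (hξ n hn _).measurableSet _

lemma evidence_nonneg (hprior : HasFiniteEntropy P.prior)
    (hcrossover : ∀ n u, P.crossover n u ∈ Set.Ioo (0 : ℝ) (1 / 2)) (hξ : P.Admissible ξ) :
    ∀ n ≤ P.horizon, ∀ y, 0 ≤ P.evidence ξ n y
  | 0, _, _ => zero_le_one
  | n + 1, hn, _ =>
    mul_nonneg (evidence_nonneg hprior hcrossover hξ n (by omega) _)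
      (responseProb_pos (hcrossover _ _) (hξ n hn _).measurableSet
        (hasFiniteEntropy_posterior hprior hcrossover hξ n (by omega) _) _).le

lemma sum_evidence (hprior : HasFiniteEntropy P.prior)
    (hcrossover : ∀ n u, P.crossover n u ∈ Set.Ioo (0 : ℝ) (1 / 2)) (hξ : P.Admissible ξ) :
    ∀ n ≤ P.horizon, ∑ y, P.evidence ξ n y = 1
  | 0, _ => by simp [evidence]
  | n + 1, hn => by
    rw [sum_fin_succ_bool, ← sum_evidence hprior hcrossover hξ n (by omega)]
    refine Finset.sum_congr rfl fun y _ => ?_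
    simp only [evidence, Fin.init_snoc, Fin.snoc_last]
    rw [← Finset.mul_sum, sum_responseProb (hξ n hn y).measurableSet _
      (hasFiniteEntropy_posterior hprior hcrossover hξ n (by omega) y), mul_one]

/-- Two factorizations of the joint density of target and responses; the Bayes normalizers
accumulate into the evidence. -/
lemma prior_mul_likelihood (hprior : HasFiniteEntropy P.prior)
    (hcrossover : ∀ n u, P.crossover n u ∈ Set.Ioo (0 : ℝ) (1 / 2)) (hξ : P.Admissible ξ) :
    ∀ n ≤ P.horizon, ∀ y x, P.prior x * P.likelihood ξ n x y =
      P.evidence ξ n y * P.posterior ξ n y x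
  | 0, _, _, _ => by simp [likelihood, evidence, posterior]
  | n + 1, hn, y, x => by
    rw [likelihood, evidence, posterior, mul_assoc,
      responseProb_mul_bayesUpdate (hcrossover _ _) (hξ n hn _).measurableSet
        (hasFiniteEntropy_posterior hprior hcrossover hξ n (by omega) _), ← mul_assoc,
      prior_mul_likelihood hprior hcrossover hξ n (by omega)]
    ring

lemma measurable_likelihood (hξ : P.Admissible ξ) :
    ∀ n ≤ P.horizon, ∀ y, Measurable fun x => P.likelihood ξ n x y
  | 0, _, _ => measurable_const
  | n + 1, hn, y => by
    simp only [likelihood]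
    exact (measurable_likelihood hξ n (by omega) _).mul
      ((measurable_of_countable fun z => bsc _ z _).comp
        (measurable_truth (hξ n hn _).measurableSet))

/-- The integral against the joint law of a function of the responses. -/
lemma integral_law (hmeas : Measurable P.prior) (hprior : HasFiniteEntropy P.prior)
    (hcrossover : ∀ n u, P.crossover n u ∈ Set.Ioo (0 : ℝ) (1 / 2)) (hξ : P.Admissible ξ)
    (f : (Fin P.horizon → Bool) → ℝ) :
    ∫ ω, f ω.2 ∂(P.law ξ) = ∑ y, P.evidence ξ P.horizon y * f y := by
  have hpost := hasFiniteEntropy_posterior hprior hcrossover hξ P.horizon le_rfl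
  have hev := evidence_nonneg hprior hcrossover hξ P.horizon le_rfl
  have hm : Measurable fun ω : Target d × (Fin P.horizon → Bool) =>
      P.prior ω.1 * P.likelihood ξ P.horizon ω.1 ω.2 :=
    measurable_from_prod_countable_left fun y =>
      hmeas.mul (measurable_likelihood hξ P.horizon le_rfl y)
  rw [law, integral_withDensity_eq_integral_toReal_smul hm.ennreal_ofReal (by simp)]
  have hcongr (ω : Target d × (Fin P.horizon → Bool)) :
      (ENNReal.ofReal (P.prior ω.1 * P.likelihood ξ P.horizon ω.1 ω.2)).toReal • f ω.2 =
        P.prior ω.1 * P.likelihood ξ P.horizon ω.1 ω.2 * f ω.2 := by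
    rw [prior_mul_likelihood hprior hcrossover hξ P.horizon le_rfl, smul_eq_mul,
      ENNReal.toReal_ofReal (mul_nonneg (hev _) ((hpost _).nonneg _))]
  simp only [hcongr]
  have hint : Integrable (fun ω : Target d × (Fin P.horizon → Bool) =>
      P.prior ω.1 * P.likelihood ξ P.horizon ω.1 ω.2 * f ω.2)
      ((volume : Measure (Target d)).prod Measure.count) := by
    refine (integrable_prod_iff' (hm.mul ((measurable_of_countable f).comp
      measurable_snd)).aestronglyMeasurable).2 ⟨Filter.Eventually.of_forall fun y => ?_, Integrable.of_finite⟩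
    simp only [prior_mul_likelihood hprior hcrossover hξ P.horizon le_rfl]
    exact ((hpost y).integrable.const_mul (P.evidence ξ P.horizon y)).mul_const (f y)
  -- Integrating out the target first leaves the evidence, since each posterior has total mass one.
  rw [integral_prod_symm _ hint, integral_count]
  refine Finset.sum_congr rfl fun y _ => ?_
  simp only [prior_mul_likelihood hprior hcrossover hξ P.horizon le_rfl]
  rw [integral_mul_const, integral_const_mul, (hpost y).integral_eq_one, mul_one]

lemma objective_eq_expectedValue (hmeas : Measurable P.prior)
    (hprior : HasFiniteEntropy P.prior)
    (hcrossover : ∀ n u, P.crossover n u ∈ Set.Ioo (0 : ℝ) (1 / 2)) (hξ : P.Admissible ξ) :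
    P.objective ξ = P.expectedValue ξ P.horizon :=
  integral_law hmeas hprior hcrossover hξ fun y =>
    entropy (P.posterior ξ P.horizon y) + P.γ * P.totalCost ξ P.horizon y

lemma expectedValue_zero : P.expectedValue ξ 0 = entropy P.prior := by
  simp [expectedValue, evidence, posterior, totalCost]

/-- Condition on the first `n` responses: the new cost is already determined by them, so only the
entropy is averaged over the next response. -/
lemma expectedValue_succ (hprior : HasFiniteEntropy P.prior)
    (hcrossover : ∀ n u, P.crossover n u ∈ Set.Ioo (0 : ℝ) (1 / 2)) (hξ : P.Admissible ξ)
    {n : ℕ} (hn : n < P.horizon) :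
    P.expectedValue ξ (n + 1) = P.expectedValue ξ n -
      ∑ y, P.evidence ξ n y *
        (mutualInfo (answerLaw (P.posterior ξ n y) (ξ.query n y))
          (bsc (P.crossover n (ξ.player n y))) -
            P.γ * P.cost n (ξ.player n y) (ξ.query n y)) := by
  rw [expectedValue, sum_fin_succ_bool, expectedValue, ← Finset.sum_sub_distrib]
  refine Finset.sum_congr rfl fun y _ => ?_
  have hA := (hξ n hn y).measurableSet
  have hp := hasFiniteEntropy_posterior hprior hcrossover hξ n hn.le y
  have hH := sum_responseProb_mul_entropy (hcrossover n (ξ.player n y)) hA hp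
  have hS := sum_responseProb hA (P.crossover n (ξ.player n y)) hp
  simp only [evidence, posterior, totalCost, Fin.init_snoc, Fin.snoc_last]
  simp only [mul_assoc, mul_add, Finset.sum_add_distrib, ← Finset.mul_sum, ← Finset.sum_mul,
    hH, hS]
  ring

end Problem

end TwentyQuestions

end

open TwentyQuestions TwentyQuestions.Problem in
theorem corollary1 {d M : ℕ} (P : TwentyQuestions.Problem d M)
    (hprior : TwentyQuestions.IsDensityOn P.domain P.prior)
    (hentropy : MeasureTheory.Integrable
      (fun x => P.prior x * Real.logb 2 (P.prior x)) MeasureTheory.volume)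
    (hcrossover : ∀ n u, P.crossover n u ∈ Set.Ioo (0 : ℝ) (1 / 2))
    (hγ : 0 ≤ P.γ)
    (K : ℕ → Fin M → ℝ)
    (hcost : ∀ n u A, TwentyQuestions.IsQueryRegion P.domain (P.maxRect n u) A →
      P.cost n u A = K n u)
    (ζ : TwentyQuestions.Policy d M)
    (hadmissible : P.Admissible ζ)
    (hplayer : ∀ n < P.horizon, ∀ y : Fin n → Bool,
      IsMaxOn (fun u => P.playerCapacity n u - P.γ * K n u) Set.univ (ζ.player n y))
    (hbisection : ∀ n < P.horizon, ∀ y : Fin n → Bool,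
      TwentyQuestions.mass (P.posterior ζ n y) (ζ.query n y) = 1 / 2) :
    P.IsOptimal ζ := by
  have hp : HasFiniteEntropy P.prior :=
    ⟨hprior.nonneg, hprior.integrable, hprior.integral_eq_one, hentropy⟩
  -- The all-`false` history is an arbitrary choice: each history selects a maximizer of the same
  -- function, so the value is the same.
  let G : ℕ → ℝ := fun n =>
    P.playerCapacity n (ζ.player n fun _ => false) - P.γ * K n (ζ.player n fun _ => false)
  have hG (n) (hn : n < P.horizon) (u : Fin M) : P.playerCapacity n u - P.γ * K n u ≤ G n :=
    hplayer n hn _ (Set.mem_univ u)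
  have hGζ (n) (hn : n < P.horizon) (y : Fin n → Bool) :
      P.playerCapacity n (ζ.player n y) - P.γ * K n (ζ.player n y) = G n :=
    le_antisymm (hG n hn _) (hplayer n hn y (Set.mem_univ _))
  have lower (ξ : TwentyQuestions.Policy d M) (hξ : P.Admissible ξ) (n : ℕ)
      (hn : n ≤ P.horizon) :
      TwentyQuestions.entropy P.prior - ∑ k ∈ Finset.range n, G k ≤ P.expectedValue ξ n := by
    induction n with
    | zero => simp [expectedValue_zero]
    | succ n ih =>
      have hn' : n < P.horizon := hn
      rw [expectedValue_succ hp hcrossover hξ hn', Finset.sum_range_succ]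
      have hgain : ∑ y, P.evidence ξ n y *
          (mutualInfo (answerLaw (P.posterior ξ n y) (ξ.query n y))
            (bsc (P.crossover n (ξ.player n y))) -
              P.γ * P.cost n (ξ.player n y) (ξ.query n y)) ≤ ∑ y, P.evidence ξ n y * G n := by
        refine Finset.sum_le_sum fun y _ =>
          mul_le_mul_of_nonneg_left ?_ (evidence_nonneg hp hcrossover hξ n hn'.le y)
        have hq := hasFiniteEntropy_posterior hp hcrossover hξ n hn'.le y
        have hI := mutualInfo_le_capacity_bsc (hcrossover n (ξ.player n y))
          (answerLaw_nonneg hq.nonneg (ξ.query n y))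
          (sum_answerLaw (hξ n hn' y).measurableSet hq.integrable hq.integral_eq_one)
        rw [hcost n _ _ (hξ n hn' y)]
        exact (sub_le_sub_right hI _).trans (hG n hn' _)
      rw [← Finset.sum_mul, sum_evidence hp hcrossover hξ n hn'.le, one_mul] at hgain
      linarith [ih hn'.le]
  have attained (n : ℕ) (hn : n ≤ P.horizon) :
      P.expectedValue ζ n = TwentyQuestions.entropy P.prior - ∑ k ∈ Finset.range n, G k := by
    induction n with
    | zero => simp [expectedValue_zero]
    | succ n ih =>
      have hn' : n < P.horizon := hn
      have hgain (y : Fin n → Bool) :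
          mutualInfo (answerLaw (P.posterior ζ n y) (ζ.query n y))
            (bsc (P.crossover n (ζ.player n y))) -
              P.γ * P.cost n (ζ.player n y) (ζ.query n y) = G n := by
        rw [hcost n _ _ (hadmissible n hn' y), mutualInfo_bsc_eq_capacity (hcrossover n _)
          (answerLaw_eq_half (hadmissible n hn' y).measurableSet
            (hasFiniteEntropy_posterior hp hcrossover hadmissible n hn'.le y)
            (hbisection n hn' y))]
        exact hGζ n hn' y
      rw [expectedValue_succ hp hcrossover hadmissible hn', Finset.sum_range_succ, ih hn'.le]
      simp only [hgain]
      rw [← Finset.sum_mul, sum_evidence hp hcrossover hadmissible n hn'.le]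
      ring
  refine ⟨hadmissible, ⟨ζ, hadmissible, rfl⟩, ?_⟩
  rintro _ ⟨ξ, hξ, rfl⟩
  rw [objective_eq_expectedValue hprior.measurable hp hcrossover hadmissible,
    objective_eq_expectedValue hprior.measurable hp hcrossover hξ, attained _ le_rfl]
  exact lower ξ hξ _ le_rfl
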